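/- Graphs are finite multigraphs: loops and parallel edges are allowed, and parallel edges are regarded as distinct. For a graph $X=(V,E)$, every edge (also every loop) gives two arcs $e,\bar e$, inverse to each other, with opposite directions; $o(e)$ and $t(e)$ denote the origin and terminus of an arc. A *cycle* is a sequence $c=(e_1,\dots,e_l)$, $l\ge 1$, of arcs with $t(e_i)=o(e_{i+1})$ for $1\le i\le l-1$ and $t(e_l)=o(e_1)$; it has *backtracking* if $e_i=\overline{e_{i+1}}$ for some $1\le i\le l-1$, has a *tail* if $e_1=\overline{e_l}$, and is *primitive* if it is not a cycle $b$ repeated $r$ times for some $r\ge2$. A *prime cycle* $[c]$ is the class, up to cyclic permutation, of a primitive cycle without backtracking or tail. Given one complex variable $u_e$ for each arc $e$, put $g(c)=\prod_{e \text{ in } c}u_e$ (with multiplicity). The *edge zeta function* of $X$ is, for $\vec u$ sufficiently near $0$, $$\zeta_X(\vec u)=\prod_{[c]\text{ prime cycle}}(1-g(c))^{-1}.$$ For a set $R$ of edges, the edge-induced subgraph $\langle R\rangle$ has edge set $R$ and as vertices those incident to an edge of $R$. Let $s_e(C_k,X)$ be the number of edge-induced subgraphs of $X$ isomorphic to the cycle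 graph $C_k$ ($k\ge3$), and, for $X$ with $n\ge3$ vertices, let $\mathrm{Ham}(X)=s_e(C_n,X)$ be the number of Hamiltonian cycles of $X$. **Corollary (Cycles and Hamiltonian cycles).** Let $X$ be a graph on $n$ vertices. Then for every $k\ge3$, in particular for $k=3,\dots,n$, the number $s_e(C_k,X)$ is determined by $\zeta_X(\vec u)$. In particular, if $n\ge 3$, $\mathrm{Ham}(X)$ is determined by $\zeta_X(\vec u)$ and $n$. Here "determined" is meant with the variables of an arc and of its inverse arc being identified as such. That is: let $X$ and $Y$ be graphs, let $A$ be a finite set with a map $\iota:A\to A$, and let the arcs of $X$ and the arcs of $Y$ each be labelled injectively by elements of $A$ so that, in both graphs, the label of $\bar e$ is $\iota$ of the label of $e$. Suppose that $\zeta_X=\zeta_Y$ as functions of $\vec u\in\mathbb C^A$ near $0$, where $u_e$ is the coordinate of $\vec u$ at the label of $e$. Then $s_e(C_k,X)=s_e(C_k,Y)$ for every $k\ge 3$; and if $X$ and $Y$ have the same number $n\ge 3$ of vertices, then $\mathrm{Ham}(X)=\mathrm{Ham}(Y)$. -/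

import Mathlib

open Filter Topology

noncomputable section

namespace Graph

variable {α β α' β' : Type*}

/-- The arcs of the symmetric digraph `D(X)` of a multigraph `X`: each edge (loops included) gives
two arcs, interchanged by `arcInv`. -/
abbrev Arc (X : Graph α β) : Type _ := X.edgeSet × Bool

/-- An ordered pair of ends of an edge. Which of the two orders is picked is immaterial: the arc
`(e, true)` runs from the first to the second of these ends, and `(e, false)` runs back. -/
def arcEnds (X : Graph α β) (e : X.edgeSet) : α × α :=
  ((X.exists_isLink_of_mem_edgeSet e.2).choose,
    (X.exists_isLink_of_mem_edgeSet e.2).choose_spec.choose)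

theorem isLink_arcEnds (X : Graph α β) (e : X.edgeSet) :
    X.IsLink e (X.arcEnds e).1 (X.arcEnds e).2 :=
  (X.exists_isLink_of_mem_edgeSet e.2).choose_spec.choose_spec

/-- The inverse arc. -/
def arcInv (X : Graph α β) (a : X.Arc) : X.Arc := (a.1, !a.2)

/-- The origin `o(a)` of an arc. -/
def arcOrigin (X : Graph α β) (a : X.Arc) : α :=
  if a.2 then (X.arcEnds a.1).1 else (X.arcEnds a.1).2

/-- The terminus `t(a)` of an arc. -/
def arcTerminus (X : Graph α β) (a : X.Arc) : α :=
  if a.2 then (X.arcEnds a.1).2 else (X.arcEnds a.1).1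

/-- `c = (e₁, …, eₙ)`, `n ≥ 1`, is a cycle in `X`: `t(eᵢ) = o(eᵢ₊₁)` for `1 ≤ i ≤ n - 1`, and
`t(eₙ) = o(e₁)`. -/
def IsCyc (X : Graph α β) (c : List X.Arc) : Prop :=
  c ≠ [] ∧ c.IsChain (fun a b => X.arcTerminus a = X.arcOrigin b) ∧
    ∀ a ∈ c.getLast?, ∀ b ∈ c.head?, X.arcTerminus a = X.arcOrigin b

/-- `c` has backtracking: two consecutive entries `a, b` satisfy `a = b⁻¹`. -/
def HasBacktracking (X : Graph α β) (c : List X.Arc) : Prop :=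
  ∃ a b : X.Arc, [a, b] <:+: c ∧ a = X.arcInv b

/-- `c` has a tail: its first entry is the inverse of its last entry. -/
def HasTail (X : Graph α β) (c : List X.Arc) : Prop :=
  ∃ a ∈ c.head?, ∃ b ∈ c.getLast?, a = X.arcInv b

/-- `c` is primitive: it is not the `r`-multiple of a cycle `b` for any `r ≥ 2`. -/
def IsPrimitiveCyc (X : Graph α β) (c : List X.Arc) : Prop :=
  ∀ (b : List X.Arc) (r : ℕ), X.IsCyc b → 2 ≤ r → c ≠ (List.replicate r b).flatten

/-- The prime cycles `[c]` of `X`: classes, up to cyclic permutation, of primitive cycles without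
backtracking and tail. (`Cycle A` is the type of lists in `A` up to rotation.) -/
def PrimeCycle (X : Graph α β) : Type _ :=
  {C : Cycle X.Arc // ∃ c : List X.Arc, (c : Cycle X.Arc) = C ∧
    X.IsCyc c ∧ ¬ X.HasBacktracking c ∧ ¬ X.HasTail c ∧ X.IsPrimitiveCyc c}

/-- `g(c)`: the product of the `u_a` over the arcs `a` in `c`, with multiplicity. -/
def cycleWeight (X : Graph α β) (u : X.Arc → ℂ) (C : X.PrimeCycle) : ℂ :=
  (C.1.toMultiset.map u).prod

/-- The edge zeta function `ζ_X(u) = ∏_{[c]} (1 - g(c))⁻¹`, for `u` near `0`. -/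
def edgeZeta (X : Graph α β) (u : X.Arc → ℂ) : ℂ :=
  ∏' C : X.PrimeCycle, (1 - X.cycleWeight u C)⁻¹

/-- Isomorphisms of multigraphs. -/
structure Iso (G : Graph α β) (H : Graph α' β') where
  vertexEquiv : G.vertexSet ≃ H.vertexSet
  edgeEquiv : G.edgeSet ≃ H.edgeSet
  isLink_iff : ∀ (e : G.edgeSet) (x y : G.vertexSet),
    G.IsLink e x y ↔ H.IsLink (edgeEquiv e) (vertexEquiv x) (vertexEquiv y)

/-- The edge-induced subgraph `⟨R⟩`: its edges are those in `R`, its vertices are the vertices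
incident to some edge in `R`. -/
def edgeInduced (X : Graph α β) (R : Set β) : Graph α β where
  vertexSet := {x | ∃ e ∈ R, X.Inc e x}
  edgeSet := X.edgeSet ∩ R
  IsLink e x y := e ∈ R ∧ X.IsLink e x y
  isLink_symm _ _ := { symm := fun _ _ h => ⟨h.1, h.2.symm⟩ }
  eq_or_eq_of_isLink_of_isLink _ _ _ _ _ h h' := h.2.left_eq_or_eq h'.2
  edge_mem_iff_exists_isLink _ :=
    ⟨fun h => by
      obtain ⟨x, y, hxy⟩ := X.exists_isLink_of_mem_edgeSet h.1
      exact ⟨x, y, h.2, hxy⟩,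
    fun ⟨_, _, h⟩ => ⟨h.2.edge_mem, h.1⟩⟩
  left_mem_of_isLink _ _ y h := ⟨_, h.1, y, h.2⟩

/-- `s_e(W, X)`: the number of edge-induced subgraphs `⟨R⟩`, `R ⊆ E(X)`, isomorphic to `W`. -/
def edgeInducedCount (W : Graph α' β') (X : Graph α β) : ℕ :=
  {R : Set β | R ⊆ X.edgeSet ∧ Nonempty (Iso (X.edgeInduced R) W)}.ncard

/-- The cycle graph `C_k` (for `k ≥ 3`). -/
def cycleC (k : ℕ) : Graph (Fin k) (Sym2 (Fin k)) := ofSimpleGraph (SimpleGraph.cycleGraph k)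

/-- `Ham(X)`: the number of edge-induced subgraphs isomorphic to `C_n`, where `n = |V(X)|`
(for `n ≥ 3`). -/
def hamCount (X : Graph α β) : ℕ := edgeInducedCount (cycleC X.vertexSet.ncard) X

end Graph

end

/-! ### Sums over words and infinite products -/

/-! Evaluate both zeta functions at `t • 1_S`, with `S` a set of labels and `t > 0` small. Only
prime cycles with all labels in `S` contribute, each a real factor greater than `1`; so the value
differs from `1` exactly when `S` supports a prime cycle. Thus the zeta function determines the
family of supporting sets (`supportsPrime_of_edgeZeta_eq`), and with it the minimal ones.

Among the sets `S` disjoint from `ι '' S`, the minimal ones are exactly the label sets of circuits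
without repeated vertices (`minimal_supportsPrime_iff`). Circuits of length `k ≥ 3` satisfy this
disjointness automatically and are the oriented copies of `C_k`. Passing to `S ∪ ι '' S` forgets the
orientation, so counting these unions counts the copies (`image_labelSet_cycles`). -/

theorem summable_pow_length {κ : Type*} [Finite κ] {r : ℝ} (hr : 0 ≤ r)
    (h : Nat.card κ * r < 1) : Summable fun l : List κ => r ^ l.length := by
  have := Fintype.ofFinite κ
  rw [← (Equiv.sigmaFiberEquiv (List.length (α := κ))).summable_iff]
  have hterm : ∀ x : (n : ℕ) × {l : List κ // l.length = n},
      ((fun l : List κ => r ^ l.length) ∘ Equiv.sigmaFiberEquiv List.length) x = r ^ x.1 := by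
    rintro ⟨n, l, rfl⟩
    rfl
  have hfin : ∀ n : ℕ, Finite {l : List κ // l.length = n} := fun n =>
    inferInstanceAs (Finite (List.Vector κ n))
  rw [summable_congr hterm, summable_sigma_of_nonneg fun x => pow_nonneg hr _]
  refine ⟨fun n => have := hfin n; Summable.of_finite, ?_⟩
  refine (summable_geometric_of_lt_one (by positivity) h).congr fun n => ?_
  have h1 : Nat.card {l : List κ // l.length = n} = Nat.card κ ^ n := by
    have : Nat.card (List.Vector κ n) = Nat.card κ ^ n := by simp [card_vector]
    exact this
  change _ = ∑' _ : {l : List κ // l.length = n}, r ^ n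
  rw [tsum_const, h1, mul_pow]
  simp

/-- Every factor is at least `1`, so each partial product containing `i₀` is at least that factor,
which exceeds `1`. Convergence has to be proved, since a divergent `∏'` takes the default value `1`;
it follows from `(1 - g)⁻¹ - 1 ≤ 2 * g` for `g ≤ 1 / 2`. -/
theorem tprod_inv_one_sub_ne_one {κ : Type*} {g : κ → ℝ} (h0 : ∀ i, 0 ≤ g i)
    (h1 : ∀ i, g i ≤ 1 / 2) (hs : Summable g) {i₀ : κ} (hi₀ : 0 < g i₀) :
    ∏' i, (1 - (g i : ℂ))⁻¹ ≠ 1 := by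
  have hfactor : ∀ i, 1 + g i ≤ (1 - g i)⁻¹ := fun i => by
    rw [← one_div, le_div_iff₀ (by linarith [h1 i])]
    nlinarith [h0 i]
  have hmul : Multipliable fun i => (1 - g i)⁻¹ := by
    have hs' : Summable fun i => (1 - g i)⁻¹ - 1 := by
      refine Summable.of_nonneg_of_le (fun i => ?_) (fun i => ?_) (hs.mul_left 2)
      · linarith [hfactor i, h0 i]
      · rw [sub_le_iff_le_add, ← one_div, div_le_iff₀ (by linarith [h1 i])]
        nlinarith [h0 i, h1 i]
    simpa using Real.multipliable_one_add_of_summable hs'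
  have hlt : 1 < ∏' i, (1 - g i)⁻¹ := by
    refine lt_of_lt_of_le (by linarith [hfactor i₀] : 1 < (1 - g i₀)⁻¹) ?_
    classical
    refine ge_of_tendsto hmul.hasProd ?_
    filter_upwards [eventually_ge_atTop {i₀}] with s hs
    rw [← Finset.mul_prod_erase s _ (Finset.singleton_subset_iff.1 hs)]
    refine le_mul_of_one_le_right (by linarith [hfactor i₀]) ?_
    exact Finset.prod_induction _ (fun x => 1 ≤ x) (fun _ _ => one_le_mul_of_one_le_of_one_le) le_rfl
      fun i _ => by linarith [hfactor i, h0 i]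
  have hcast : ∏' i, (1 - (g i : ℂ))⁻¹ = ((∏' i, (1 - g i)⁻¹ : ℝ) : ℂ) := by
    have := hmul.hasProd.map Complex.ofRealHom Complex.continuous_ofReal
    rw [← Complex.ofRealHom_eq_coe, ← this.tprod_eq]
    simp
  rw [hcast]
  exact_mod_cast hlt.ne'

namespace Graph

variable {α β α' β' A : Type*}

/-! ### Which sets of arcs support a prime cycle -/

/-- The set `T` of arcs contains all arcs of some prime cycle. -/
def SupportsPrime (X : Graph α β) (T : Set X.Arc) : Prop :=
  ∃ c : List X.Arc, X.IsCyc c ∧ ¬ X.HasBacktracking c ∧ ¬ X.HasTail c ∧ X.IsPrimitiveCyc c ∧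
    ∀ a ∈ c, a ∈ T

theorem cycleWeight_indicator_eq_pow {X : Graph α β} {T : Set X.Arc} {C : X.PrimeCycle}
    (hC : ∀ a ∈ C.1, a ∈ T) (t : ℂ) :
    X.cycleWeight (T.indicator fun _ => t) C = t ^ C.1.length := by
  obtain ⟨_, c, rfl, _⟩ := C
  have hmap : c.map (T.indicator fun _ => t) = c.map fun _ => t :=
    List.map_congr_left fun a ha => Set.indicator_of_mem (hC a ha) _
  change ((c : Multiset X.Arc).map _).prod = t ^ c.length
  rw [Multiset.map_coe, Multiset.prod_coe, hmap]
  simp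

theorem cycleWeight_indicator_eq_zero {X : Graph α β} {T : Set X.Arc} {C : X.PrimeCycle}
    (hC : ¬ ∀ a ∈ C.1, a ∈ T) (t : ℂ) : X.cycleWeight (T.indicator fun _ => t) C = 0 := by
  push Not at hC
  obtain ⟨a, ha, haT⟩ := hC
  obtain ⟨_, c, rfl, _⟩ := C
  exact Multiset.prod_eq_zero
    (Multiset.mem_map.2 ⟨a, Multiset.mem_coe.2 ha, Set.indicator_of_notMem haT _⟩)

theorem cycleWeight_indicator (X : Graph α β) (T : Set X.Arc) (t : ℝ) (C : X.PrimeCycle) :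
    X.cycleWeight (T.indicator fun _ => (t : ℂ)) C =
      (({C : X.PrimeCycle | ∀ a ∈ C.1, a ∈ T}.indicator (fun C => t ^ C.1.length) C : ℝ) : ℂ) := by
  by_cases hC : ∀ a ∈ C.1, a ∈ T
  · rw [cycleWeight_indicator_eq_pow hC,
      Set.indicator_of_mem (s := {C : X.PrimeCycle | ∀ a ∈ C.1, a ∈ T}) hC]
    push_cast
    rfl
  · rw [cycleWeight_indicator_eq_zero hC,
      Set.indicator_of_notMem (s := {C : X.PrimeCycle | ∀ a ∈ C.1, a ∈ T}) hC]
    simp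

theorem edgeZeta_indicator_eq_one (X : Graph α β) {T : Set X.Arc} (hT : ¬ X.SupportsPrime T)
    (t : ℝ) : X.edgeZeta (T.indicator fun _ => (t : ℂ)) = 1 := by
  have h : ∀ C : X.PrimeCycle, ¬ ∀ a ∈ C.1, a ∈ T := by
    rintro ⟨_, c, rfl, h1, h2, h3, h4⟩ h
    exact hT ⟨c, h1, h2, h3, h4, h⟩
  unfold edgeZeta
  simp only [cycleWeight_indicator_eq_zero (h _)]
  simp

theorem edgeZeta_indicator_ne_one (X : Graph α β) [Finite X.Arc] {T : Set X.Arc}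
    (hT : X.SupportsPrime T) {t : ℝ} (ht0 : 0 < t) (ht : t ≤ 1 / 2)
    (htc : Nat.card X.Arc * t < 1) : X.edgeZeta (T.indicator fun _ => (t : ℂ)) ≠ 1 := by
  obtain ⟨c, h1, h2, h3, h4, h5⟩ := hT
  have hlen : ∀ C : X.PrimeCycle, t ^ C.1.length ≤ 1 / 2 := by
    rintro ⟨_, d, rfl, hd, -⟩
    refine le_trans (pow_le_of_le_one ht0.le (by linarith) ?_) ht
    simpa using hd.1
  have hsum : Summable fun C : X.PrimeCycle => t ^ C.1.length := by
    -- A representative word for each class reduces summability to that over all words in the arcs.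
    have hinj : Function.Injective fun C : X.PrimeCycle => Quotient.out C.1 := fun C D h =>
      Subtype.ext (Quotient.out_injective h)
    refine ((summable_pow_length ht0.le htc).comp_injective hinj).congr fun C => ?_
    conv_rhs => rw [← Quotient.out_eq C.1]
    rfl
  unfold edgeZeta
  simp only [cycleWeight_indicator]
  refine tprod_inv_one_sub_ne_one (i₀ := ⟨c, c, rfl, h1, h2, h3, h4⟩) (fun C => ?_) (fun C => ?_)
    (hsum.indicator _) ?_
  · exact Set.indicator_nonneg (fun _ _ => by positivity) _
  · exact Set.indicator_le' (fun C _ => hlen C) (fun _ _ => by norm_num) C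
  · rw [Set.indicator_of_mem (s := {C : X.PrimeCycle | ∀ a ∈ C.1, a ∈ T})
      (a := ⟨c, c, rfl, h1, h2, h3, h4⟩) h5]
    positivity

theorem supportsPrime_of_edgeZeta_eq [Finite A] {X : Graph α β} {Y : Graph α' β'}
    {lX : X.Arc ↪ A} {lY : Y.Arc ↪ A}
    (hzeta : ∀ᶠ u : A → ℂ in 𝓝 0, X.edgeZeta (u ∘ lX) = Y.edgeZeta (u ∘ lY)) {S : Set A}
    (hS : X.SupportsPrime (lX ⁻¹' S)) : Y.SupportsPrime (lY ⁻¹' S) := by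
  by_contra hY
  have := Finite.of_injective lX lX.injective
  -- Points of the ray through the indicator of `S` eventually enter the neighbourhood where the
  -- zeta functions agree.
  have hcont : Tendsto (fun t : ℝ => S.indicator fun _ => (t : ℂ)) (𝓝[>] 0) (𝓝 (0 : A → ℂ)) := by
    refine tendsto_nhdsWithin_of_tendsto_nhds (Continuous.tendsto' ?_ _ _ (by ext; simp))
    refine continuous_pi fun a => ?_
    by_cases ha : a ∈ S
    · simpa [ha] using Complex.continuous_ofReal
    · simpa [ha] using continuous_const
  have hsmall : ∀ᶠ t : ℝ in 𝓝[>] 0, Nat.card X.Arc * t < 1 := by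
    refine eventually_nhdsWithin_of_eventually_nhds ?_
    refine ContinuousAt.eventually_lt (by fun_prop) continuousAt_const ?_
    simp
  have hhalf : ∀ᶠ t : ℝ in 𝓝[>] 0, t ≤ 1 / 2 :=
    eventually_nhdsWithin_of_eventually_nhds (eventually_le_nhds (by norm_num))
  obtain ⟨t, h1, h2, h3, h4⟩ :=
    ((hcont.eventually hzeta).and (hsmall.and (hhalf.and self_mem_nhdsWithin))).exists
  refine X.edgeZeta_indicator_ne_one hS h4 h3 h2 (Eq.trans h1 ?_)
  exact Y.edgeZeta_indicator_eq_one hY t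

end Graph

namespace Graph

variable {α β α' β' A : Type*} {X : Graph α β}

/-! ### Closed walks and circuits -/

/-- The set `T` contains no two arcs inverse to each other. -/
def IsInvFree (X : Graph α β) (T : Set X.Arc) : Prop :=
  ∀ a ∈ T, X.arcInv a ∉ T

/-- `f` enumerates the arcs of a closed walk without repeated vertices, in cyclic order. -/
structure IsCircuit (X : Graph α β) {n : ℕ} (f : Fin (n + 1) → X.Arc) : Prop where
  terminus_eq : ∀ i, X.arcTerminus (f i) = X.arcOrigin (f (i + 1))
  injective : Function.Injective fun i => X.arcOrigin (f i)

@[simp] theorem arcOrigin_arcInv (a : X.Arc) :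
    X.arcOrigin (X.arcInv a) = X.arcTerminus a := by
  obtain ⟨e, _ | _⟩ := a <;> rfl

@[simp] theorem arcTerminus_arcInv (a : X.Arc) :
    X.arcTerminus (X.arcInv a) = X.arcOrigin a := by
  obtain ⟨e, _ | _⟩ := a <;> rfl

theorem isLink_arc (a : X.Arc) : X.IsLink a.1 (X.arcOrigin a) (X.arcTerminus a) := by
  obtain ⟨e, _ | _⟩ := a
  · exact (X.isLink_arcEnds e).symm
  · exact X.isLink_arcEnds e

theorem IsLink.exists_arc {e : β} {x y : α} (h : X.IsLink e x y) :
    ∃ a : X.Arc, a.1.1 = e ∧ X.arcOrigin a = x ∧ X.arcTerminus a = y := by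
  rcases (X.isLink_arcEnds ⟨e, h.edge_mem⟩).eq_and_eq_or_eq_and_eq h with ⟨h1, h2⟩ | ⟨h1, h2⟩
  · exact ⟨(⟨e, h.edge_mem⟩, true), rfl, h1, h2⟩
  · exact ⟨(⟨e, h.edge_mem⟩, false), rfl, h2, h1⟩

theorem eq_or_eq_arcInv {a b : X.Arc} (h : a.1 = b.1) : a = b ∨ a = X.arcInv b := by
  obtain ⟨e, s⟩ := a
  obtain ⟨e', s'⟩ := b
  obtain rfl : e = e' := h
  cases s <;> cases s' <;> simp [arcInv]

theorem isCyc_ofFn {n : ℕ} {f : Fin (n + 1) → X.Arc} :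
    X.IsCyc (List.ofFn f) ↔ ∀ i, X.arcTerminus (f i) = X.arcOrigin (f (i + 1)) := by
  have hlast : (List.ofFn f).getLast? = some (f (Fin.last n)) := by
    rw [List.getLast?_eq_some_getLast (by simp), List.getLast_ofFn]
    rfl
  have hhead : (List.ofFn f).head? = some (f 0) := by simp [List.ofFn_succ]
  rw [IsCyc, hlast, hhead, List.isChain_ofFn, Fin.forall_fin_succ' (n := n)]
  simp only [Option.mem_some_iff, forall_eq', Fin.last_add_one, Fin.coeSucc_eq_succ]
  constructor
  · rintro ⟨-, h1, h2⟩
    exact ⟨fun i => h1 i (by simp), h2⟩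
  · rintro ⟨h1, h2⟩
    exact ⟨by simp, fun i hi => h1 ⟨i, by simpa using hi⟩, h2⟩

/-- The segment between two visits to the same vertex closes up. -/
theorem IsCyc.exists_shorter {w : List X.Arc} (hw : X.IsCyc w)
    (hdup : ¬ (w.map X.arcOrigin).Nodup) :
    ∃ d : List X.Arc, X.IsCyc d ∧ d.length < w.length ∧ ∀ a ∈ d, a ∈ w := by
  obtain ⟨i, j, hij, hj, h⟩ : ∃ (i j : ℕ) (hij : i < j) (hj : j < w.length),
      X.arcOrigin w[i] = X.arcOrigin w[j] := by
    rw [List.nodup_iff_getElem?_ne_getElem?] at hdup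
    push Not at hdup
    obtain ⟨i, j, hij, hj, h⟩ := hdup
    rw [List.length_map] at hj
    refine ⟨i, j, hij, hj, ?_⟩
    simpa [hj, hij.trans hj] using h
  have hinfix : (w.drop i).take (j - i) <:+: w :=
    (List.take_prefix _ _).isInfix.trans (List.drop_suffix _ _).isInfix
  have hlen : ((w.drop i).take (j - i)).length = j - i := by simp; omega
  refine ⟨(w.drop i).take (j - i), ⟨?_, hw.2.1.infix hinfix, ?_⟩, by omega,
    fun a ha => hinfix.subset ha⟩
  · rw [← List.length_pos_iff]; omega
  · intro a ha b hb
    have hwhain := List.isChain_iff_getElem.1 hw.2.1 (j - 1) (by omega)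
    rw [List.getLast?_eq_getElem?, hlen] at ha
    rw [List.head?_eq_getElem?] at hb
    have ha' : w[j - 1] = a := by
      have : i + (j - i - 1) = j - 1 := by omega
      rw [List.getElem?_take, if_pos (by omega), List.getElem?_drop, this,
        List.getElem?_eq_getElem (by omega)] at ha
      simpa using ha
    have hb' : w[i] = b := by
      rw [List.getElem?_take, if_pos (by omega), List.getElem?_drop, add_zero,
        List.getElem?_eq_getElem (by omega)] at hb
      simpa using hb
    have : j - 1 + 1 = j := by omega
    simp only [this] at hwhain
    rw [← ha', ← hb', hwhain, h]

theorem IsCyc.exists_eq_ofFn {c : List X.Arc} (hc : X.IsCyc c) :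
    ∃ (n : ℕ) (f : Fin (n + 1) → X.Arc), c = List.ofFn f := by
  obtain ⟨n, hn⟩ : ∃ n, c.length = n + 1 :=
    Nat.exists_eq_succ_of_ne_zero (by simpa using hc.1)
  refine ⟨n, fun i => c.get (i.cast hn.symm), List.ext_getElem (by simp [hn]) fun i h1 h2 => ?_⟩
  rw [List.getElem_ofFn]
  rfl

theorem IsCyc.exists_nodup {c : List X.Arc} (hc : X.IsCyc c) :
    ∃ d : List X.Arc, X.IsCyc d ∧ (d.map X.arcOrigin).Nodup ∧ ∀ a ∈ d, a ∈ c := by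
  induction hn : c.length using Nat.strong_induction_on generalizing c with
  | _ n ih =>
    by_cases hdup : (c.map X.arcOrigin).Nodup
    · exact ⟨c, hc, hdup, fun _ => id⟩
    · obtain ⟨d, hd, hlt, hsub⟩ := hc.exists_shorter hdup
      obtain ⟨d', h1, h2, h3⟩ := ih d.length (hn ▸ hlt) hd rfl
      exact ⟨d', h1, h2, fun a ha => hsub a (h3 a ha)⟩

theorem IsCyc.exists_isCircuit {c : List X.Arc} (hc : X.IsCyc c) :
    ∃ (n : ℕ) (f : Fin (n + 1) → X.Arc), X.IsCircuit f ∧ ∀ i, f i ∈ c := by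
  obtain ⟨d, hd, hnd, hsub⟩ := hc.exists_nodup
  obtain ⟨n, f, rfl⟩ := hd.exists_eq_ofFn
  refine ⟨n, f, ⟨isCyc_ofFn.1 hd, ?_⟩, fun i => hsub _ (List.mem_ofFn.2 ⟨i, rfl⟩)⟩
  rw [List.map_ofFn, List.nodup_ofFn] at hnd
  exact hnd

theorem IsCircuit.arc_injective {n : ℕ} {f : Fin (n + 1) → X.Arc} (hf : X.IsCircuit f) :
    Function.Injective f := fun _ _ h => hf.injective (congrArg X.arcOrigin h)

/-- Backtracking or a tail would put an arc and its inverse in the range; a proper multiple would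
repeat an arc. -/
theorem IsCircuit.supportsPrime {n : ℕ} {f : Fin (n + 1) → X.Arc} (hf : X.IsCircuit f)
    (hinv : X.IsInvFree (Set.range f)) : X.SupportsPrime (Set.range f) := by
  have hmem : ∀ a ∈ List.ofFn f, a ∈ Set.range f := fun a ha => List.mem_ofFn.1 ha
  refine ⟨List.ofFn f, isCyc_ofFn.2 hf.terminus_eq, ?_, ?_, ?_, hmem⟩
  · rintro ⟨a, b, hab, rfl⟩
    exact hinv b (hmem b (hab.subset (by simp))) (hmem _ (hab.subset (by simp)))
  · rintro ⟨a, ha, b, hb, rfl⟩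
    exact hinv b (hmem b (List.mem_of_getLast? hb)) (hmem _ (List.mem_of_head? ha))
  · intro b r hb hr h
    have hnd : (List.ofFn f).Nodup := List.nodup_ofFn.2 hf.arc_injective
    obtain ⟨r, rfl⟩ := Nat.exists_eq_add_of_le' hr
    rw [h, List.replicate_succ, List.replicate_succ, List.flatten_cons, List.flatten_cons,
      List.nodup_append] at hnd
    obtain ⟨a, ha⟩ := List.exists_mem_of_ne_nil b hb.1
    exact hnd.2.2 a ha a (by simp [ha]) rfl

theorem IsCyc.exists_next {c : List X.Arc} (hc : X.IsCyc c) {a : X.Arc} (ha : a ∈ c) :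
    ∃ b ∈ c, X.arcTerminus a = X.arcOrigin b := by
  obtain ⟨n, f, rfl⟩ := hc.exists_eq_ofFn
  obtain ⟨i, rfl⟩ := List.mem_ofFn.1 ha
  exact ⟨f (i + 1), List.mem_ofFn.2 ⟨_, rfl⟩, isCyc_ofFn.1 hc i⟩

/-- Origins are distinct along a circuit, so the successor of each arc is forced and the cycle must
run all the way round. -/
theorem IsCircuit.mem_of_isCyc {n : ℕ} {f : Fin (n + 1) → X.Arc} (hf : X.IsCircuit f)
    {c : List X.Arc} (hc : X.IsCyc c) (hsub : ∀ a ∈ c, a ∈ Set.range f) :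
    ∀ i, f i ∈ c := by
  have hstep : ∀ i, f i ∈ c → f (i + 1) ∈ c := by
    intro i hi
    obtain ⟨b, hb, h⟩ := hc.exists_next hi
    obtain ⟨j, rfl⟩ := hsub b hb
    rw [hf.terminus_eq] at h
    rwa [hf.injective h]
  obtain ⟨a, ha⟩ := List.exists_mem_of_ne_nil c hc.1
  obtain ⟨i, rfl⟩ := hsub a ha
  have hadd : ∀ m : ℕ, f (i + Fin.ofNat (n + 1) m) ∈ c := by
    intro m
    induction m with
    | zero => simpa using ha
    | succ m ih =>
      have : Fin.ofNat (n + 1) (m + 1) = Fin.ofNat (n + 1) m + 1 := by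
        ext
        simp [Fin.val_add]
      rw [this, ← add_assoc]
      exact hstep _ ih
  intro j
  simpa using hadd (j - i).val

/-- Any prime cycle in `T` contains a circuit, which itself supports a prime cycle because `T` is
inverse-free; minimality makes it all of `T`. Conversely, no proper subset of a circuit carries a
cycle. -/
theorem minimal_supportsPrime_iff {T : Set X.Arc} (hinv : X.IsInvFree T) {n : ℕ} :
    (Minimal X.SupportsPrime T ∧ T.ncard = n + 1) ↔
      ∃ f : Fin (n + 1) → X.Arc, X.IsCircuit f ∧ T = Set.range f := by
  constructor
  · rintro ⟨hmin, hcard⟩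
    obtain ⟨c, hc, -, -, -, hcT⟩ := hmin.prop
    obtain ⟨m, f, hf, hfc⟩ := hc.exists_isCircuit
    have hsub : Set.range f ⊆ T := by
      rintro _ ⟨i, rfl⟩
      exact hcT _ (hfc i)
    have hT : T = Set.range f := hmin.eq_of_superset
      (hf.supportsPrime fun a ha h => hinv a (hsub ha) (hsub h)) hsub
    have hm : m = n := by
      rw [hT, ← Set.image_univ, Set.ncard_image_of_injective _ hf.arc_injective,
        Set.ncard_univ, Nat.card_fin] at hcard
      omega
    subst hm
    exact ⟨f, hf, hT⟩
  · rintro ⟨f, hf, rfl⟩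
    refine ⟨⟨hf.supportsPrime hinv, ?_⟩, ?_⟩
    · rintro T' ⟨c, hc, -, -, -, hcT⟩ hT' _ ⟨i, rfl⟩
      exact hcT _ (hf.mem_of_isCyc hc (fun a ha => hT' (hcT a ha)) i)
    · rw [← Set.image_univ, Set.ncard_image_of_injective _ hf.arc_injective,
        Set.ncard_univ, Nat.card_fin]

theorem fin_add_one_add_one_ne {n : ℕ} (i : Fin (n + 3)) : i + 1 + 1 ≠ i := by
  intro h
  rw [add_assoc, add_eq_left] at h
  have := congrArg Fin.val h
  simp [Fin.val_add, Nat.mod_eq_of_lt (show 2 < n + 3 by omega)] at this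

/-- The inverse of `f i` could only be both its successor and its predecessor, impossible for length
at least `3`. -/
theorem IsCircuit.isInvFree {n : ℕ} {f : Fin (n + 3) → X.Arc} (hf : X.IsCircuit f) :
    X.IsInvFree (Set.range f) := by
  rintro _ ⟨i, rfl⟩ ⟨j, h⟩
  have h1 : j = i + 1 := hf.injective <| by
    simp only
    rw [h, arcOrigin_arcInv, hf.terminus_eq]
  have h2 : j + 1 = i := hf.injective <| by
    simp only
    rw [← hf.terminus_eq, h, arcTerminus_arcInv]
  exact fin_add_one_add_one_ne i (h1 ▸ h2)

/-! ### Circuits and copies of the cycle graph -/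

theorem mem_edgeSet_cycleGraph {n : ℕ} {e : Sym2 (Fin (n + 3))} :
    e ∈ (SimpleGraph.cycleGraph (n + 3)).edgeSet ↔ ∃ i, e = s(i, i + 1) := by
  induction e with | _ x y
  rw [SimpleGraph.mem_edgeSet, SimpleGraph.cycleGraph_adj]
  constructor
  · rintro (h | h)
    · exact ⟨y, by rw [← h, add_sub_cancel, Sym2.eq_swap]⟩
    · exact ⟨x, by rw [← h, add_sub_cancel]⟩
  · rintro ⟨i, h⟩
    rcases Sym2.eq_iff.1 h with ⟨rfl, rfl⟩ | ⟨rfl, rfl⟩ <;> simp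

theorem sym2_succ_injective {n : ℕ} :
    Function.Injective fun i : Fin (n + 3) => s(i, i + 1) := by
  intro i j h
  rcases Sym2.eq_iff.1 h with ⟨h, -⟩ | ⟨h1, h2⟩
  · exact h
  · rw [h1] at h2
    exact absurd h2 (fin_add_one_add_one_ne j)

theorem isLink_cycleC {n : ℕ} {e : Sym2 (Fin (n + 3))} {x y : Fin (n + 3)} :
    (cycleC (n + 3)).IsLink e x y ↔
      e = s(x, y) ∧ e ∈ (SimpleGraph.cycleGraph (n + 3)).edgeSet := Iff.rfl

theorem exists_isCircuit_of_iso {n : ℕ} {R : Set β} (hR : R ⊆ X.edgeSet)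
    (φ : Iso (X.edgeInduced R) (cycleC (n + 3))) :
    ∃ f : Fin (n + 3) → X.Arc, X.IsCircuit f ∧ R = Set.range fun i => (f i).1.1 := by
  have hedge (i : Fin (n + 3)) : s(i, i + 1) ∈ (cycleC (n + 3)).edgeSet :=
    mem_edgeSet_cycleGraph.2 ⟨i, rfl⟩
  let v (i : Fin (n + 3)) : (X.edgeInduced R).vertexSet :=
    φ.vertexEquiv.symm ⟨i, Set.mem_univ i⟩
  have hlink (i : Fin (n + 3)) :
      (X.edgeInduced R).IsLink (φ.edgeEquiv.symm ⟨_, hedge i⟩) (v i) (v (i + 1)) := by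
    rw [φ.isLink_iff]
    simp only [v, Equiv.apply_symm_apply]
    exact isLink_cycleC.2 ⟨rfl, hedge i⟩
  have harc (i : Fin (n + 3)) := (hlink i).2.exists_arc
  choose f hf1 hf2 hf3 using harc
  refine ⟨f, ⟨fun i => by rw [hf2, hf3], fun i j h => ?_⟩, ?_⟩
  · simp only [hf2] at h
    simpa using congrArg Subtype.val (φ.vertexEquiv.symm.injective (Subtype.ext h))
  · ext e
    constructor
    · intro he
      obtain ⟨i, hi⟩ := mem_edgeSet_cycleGraph.1 (φ.edgeEquiv ⟨e, hR he, he⟩).2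
      refine ⟨i, (hf1 i).trans ?_⟩
      have : (⟨_, hedge i⟩ : (cycleC (n + 3)).edgeSet) = φ.edgeEquiv ⟨e, hR he, he⟩ :=
        Subtype.ext hi.symm
      rw [this, Equiv.symm_apply_apply]
    · rintro ⟨i, rfl⟩
      simp only [hf1]
      exact (φ.edgeEquiv.symm ⟨_, hedge i⟩).2.2

theorem IsCircuit.nonempty_iso {n : ℕ} {f : Fin (n + 3) → X.Arc} (hf : X.IsCircuit f) :
    Nonempty (Iso (X.edgeInduced (Set.range fun i => (f i).1.1)) (cycleC (n + 3))) := by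
  have hlink (i : Fin (n + 3)) :
      X.IsLink (f i).1.1 (X.arcOrigin (f i)) (X.arcOrigin (f (i + 1))) := by
    rw [← hf.terminus_eq]
    exact isLink_arc (f i)
  let V (i : Fin (n + 3)) : (X.edgeInduced (Set.range fun i => (f i).1.1)).vertexSet :=
    ⟨X.arcOrigin (f i), _, ⟨i, rfl⟩, (hlink i).inc_left⟩
  have hV : Function.Bijective V := by
    refine ⟨fun i j h => hf.injective (congrArg Subtype.val h), ?_⟩
    rintro ⟨x, _, ⟨i, rfl⟩, hx⟩
    rcases hx.eq_or_eq_of_isLink (hlink i) with rfl | rfl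
    · exact ⟨i, rfl⟩
    · exact ⟨i + 1, rfl⟩
  let E (i : Fin (n + 3)) : (X.edgeInduced (Set.range fun i => (f i).1.1)).edgeSet :=
    ⟨(f i).1.1, (f i).1.2, i, rfl⟩
  have hE : Function.Bijective E := by
    refine ⟨fun i j h => ?_, ?_⟩
    -- Arcs on the same edge are equal or inverse; a circuit of this length excludes the latter.
    · rcases eq_or_eq_arcInv (a := f i) (b := f j)
        (Subtype.ext (congrArg Subtype.val h :)) with h | h
      · exact hf.arc_injective h
      · exact absurd ⟨i, h⟩ (hf.isInvFree (f j) ⟨j, rfl⟩)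
    · rintro ⟨_, he, i, rfl⟩
      exact ⟨i, rfl⟩
  let D (i : Fin (n + 3)) : (cycleC (n + 3)).edgeSet :=
    ⟨s(i, i + 1), mem_edgeSet_cycleGraph.2 ⟨i, rfl⟩⟩
  have hD : Function.Bijective D := by
    refine ⟨fun i j h => sym2_succ_injective (congrArg Subtype.val h), ?_⟩
    rintro ⟨e, he⟩
    obtain ⟨i, rfl⟩ := mem_edgeSet_cycleGraph.1 he
    exact ⟨i, rfl⟩
  have hVi (i) : (Equiv.ofBijective V hV).symm (V i) = i :=
    Equiv.ofBijective_symm_apply_apply V hV i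
  have hEi (i) : (Equiv.ofBijective E hE).symm (E i) = i :=
    Equiv.ofBijective_symm_apply_apply E hE i
  let φV : (X.edgeInduced (Set.range fun i => (f i).1.1)).vertexSet ≃
      (cycleC (n + 3)).vertexSet :=
    (Equiv.ofBijective V hV).symm.trans (Equiv.Set.univ _).symm
  let φE : (X.edgeInduced (Set.range fun i => (f i).1.1)).edgeSet ≃ (cycleC (n + 3)).edgeSet :=
    (Equiv.ofBijective E hE).symm.trans (Equiv.ofBijective D hD)
  have hφV (i) : (φV (V i)).1 = i := hVi i
  have hφE (i) : (φE (E i)).1 = s(i, i + 1) := congrArg (fun i => (D i).1) (hEi i)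
  refine ⟨⟨φV, φE, ?_⟩⟩
  intro e x y
  obtain ⟨i, rfl⟩ := hE.2 e
  obtain ⟨j, rfl⟩ := hV.2 x
  obtain ⟨l, rfl⟩ := hV.2 y
  rw [hφV, hφV, hφE, isLink_cycleC]
  change ((f i).1.1 ∈ _ ∧ X.IsLink (f i).1.1 (X.arcOrigin (f j)) (X.arcOrigin (f l))) ↔ _
  rw [(hlink i).isLink_iff_sym2_eq, and_iff_right ⟨i, rfl⟩,
    and_iff_left (mem_edgeSet_cycleGraph.2 ⟨i, rfl⟩)]
  exact (Sym2.map.injective hf.injective).eq_iff (a := s(i, i + 1)) (b := s(j, l))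

/-! ### Reading off the cycles from the labels -/

/-- The labels of the two arcs of each edge in `R`. -/
def labelSet (l : X.Arc ↪ A) (R : Set β) : Set A := l '' {a | a.1.1 ∈ R}

theorem labelSet_injOn (l : X.Arc ↪ A) : Set.InjOn (labelSet l) {R | R ⊆ X.edgeSet} := by
  have key : ∀ R R' : Set β, R ⊆ X.edgeSet → labelSet l R = labelSet l R' → R ⊆ R' := by
    intro R R' hR h e he
    have hmem : l (⟨e, hR he⟩, true) ∈ labelSet l R' := h ▸ ⟨_, he, rfl⟩
    obtain ⟨a, ha, hal⟩ := hmem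
    rw [l.injective hal] at ha
    exact ha
  exact fun R hR R' hR' h => (key R R' hR h).antisymm (key R' R hR' h.symm)

theorem labelSet_edges {ι : A → A} {l : X.Arc ↪ A} (hl : ∀ a, l (X.arcInv a) = ι (l a))
    (T : Set X.Arc) : labelSet l ((fun a => a.1.1) '' T) = l '' T ∪ ι '' (l '' T) := by
  ext x
  constructor
  · rintro ⟨a, ⟨b, hb, hab⟩, rfl⟩
    rcases eq_or_eq_arcInv (Subtype.ext hab.symm) with rfl | rfl
    · exact Or.inl ⟨_, hb, rfl⟩
    · exact Or.inr ⟨_, ⟨b, hb, rfl⟩, (hl b).symm⟩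
  · rintro (⟨a, ha, rfl⟩ | ⟨_, ⟨a, ha, rfl⟩, rfl⟩)
    · exact ⟨a, ⟨a, ha, rfl⟩, rfl⟩
    · exact ⟨X.arcInv a, ⟨a, ha, rfl⟩, hl a⟩

theorem isInvFree_iff_disjoint {ι : A → A} {l : X.Arc ↪ A}
    (hl : ∀ a, l (X.arcInv a) = ι (l a)) (T : Set X.Arc) :
    X.IsInvFree T ↔ Disjoint (l '' T) (ι '' (l '' T)) := by
  rw [Set.disjoint_right]
  simp only [Set.forall_mem_image, ← hl, l.injective.mem_set_image]
  rfl

/-- A minimal `S` contains no label outside the range of `l`, since discarding such labels leaves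
the preimage unchanged. -/
theorem minimal_preimage_iff (l : X.Arc ↪ A) (S : Set A) :
    Minimal (fun S => X.SupportsPrime (l ⁻¹' S)) S ↔
      ∃ T, Minimal X.SupportsPrime T ∧ S = l '' T := by
  have hpre (T : Set X.Arc) : l ⁻¹' (l '' T) = T := Set.preimage_image_eq T l.injective
  constructor
  · intro h
    refine ⟨l ⁻¹' S, ⟨h.prop, fun T' hT' hsub => ?_⟩, ?_⟩
    · have := h.le_of_le (y := l '' T') (by simpa only [hpre] using hT')
        (Set.image_subset_iff.2 hsub)
      exact fun a ha => l.injective.mem_set_image.1 (this ha)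
    · exact h.eq_of_superset (by simpa only [hpre] using h.prop) (Set.image_preimage_subset _ _)
  · rintro ⟨T, hT, rfl⟩
    refine ⟨by simpa only [hpre] using hT.prop, fun S' hS' hsub => ?_⟩
    refine Set.image_subset_iff.2 (hT.le_of_le hS' ?_)
    exact (Set.preimage_mono hsub).trans (hpre T).le

/-- The right-hand side involves `X` only through which label sets support a prime cycle, which the
zeta function determines. -/
theorem image_labelSet_cycles {ι : A → A} {l : X.Arc ↪ A} (hl : ∀ a, l (X.arcInv a) = ι (l a))
    (n : ℕ) :
    labelSet l '' {R | R ⊆ X.edgeSet ∧ Nonempty (Iso (X.edgeInduced R) (cycleC (n + 3)))} =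
      {U | ∃ S : Set A, Minimal (fun S => X.SupportsPrime (l ⁻¹' S)) S ∧ S.ncard = n + 3 ∧
        Disjoint S (ι '' S) ∧ U = S ∪ ι '' S} := by
  have hrange (f : Fin (n + 3) → X.Arc) :
      (Set.range fun i => (f i).1.1) = (fun a : X.Arc => a.1.1) '' Set.range f :=
    Set.range_comp (fun a : X.Arc => a.1.1) f
  ext U
  constructor
  · rintro ⟨R, ⟨hR, ⟨φ⟩⟩, rfl⟩
    obtain ⟨f, hf, rfl⟩ := exists_isCircuit_of_iso hR φ
    obtain ⟨hmin, hcard⟩ := (minimal_supportsPrime_iff hf.isInvFree).2 ⟨f, hf, rfl⟩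
    refine ⟨l '' Set.range f, (minimal_preimage_iff l _).2 ⟨_, hmin, rfl⟩, ?_,
      (isInvFree_iff_disjoint hl _).1 hf.isInvFree, ?_⟩
    · rw [Set.ncard_image_of_injective _ l.injective, hcard]
    · rw [hrange, labelSet_edges hl]
  · rintro ⟨S, hS, hcard, hdisj, rfl⟩
    obtain ⟨T, hT, rfl⟩ := (minimal_preimage_iff l S).1 hS
    rw [Set.ncard_image_of_injective _ l.injective] at hcard
    obtain ⟨f, hf, rfl⟩ := (minimal_supportsPrime_iff
      ((isInvFree_iff_disjoint hl T).2 hdisj)).1 ⟨hT, hcard⟩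
    refine ⟨Set.range fun i => (f i).1.1, ⟨?_, hf.nonempty_iso⟩, ?_⟩
    · rintro _ ⟨i, rfl⟩
      exact (f i).1.2
    · rw [hrange, labelSet_edges hl]

end Graph

theorem mainTheorem4 {α β α' β' A : Type*} [Finite A] (X : Graph α β) (Y : Graph α' β')
    (hVX : X.vertexSet.Finite) (hEX : X.edgeSet.Finite)
    (hVY : Y.vertexSet.Finite) (hEY : Y.edgeSet.Finite)
    -- the arcs of `X` and of `Y` are labelled by indeterminates from a common finite set `A`,
    -- with `ι` telling which indeterminates belong to an arc and its inverse arc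
    (ι : A → A) (lX : X.Arc ↪ A) (lY : Y.Arc ↪ A)
    (hlX : ∀ a, lX (X.arcInv a) = ι (lX a)) (hlY : ∀ a, lY (Y.arcInv a) = ι (lY a))
    (hzeta : ∀ᶠ u : A → ℂ in 𝓝 0, X.edgeZeta (u ∘ lX) = Y.edgeZeta (u ∘ lY)) :
    (∀ k : ℕ, 3 ≤ k →
      Graph.edgeInducedCount (Graph.cycleC k) X = Graph.edgeInducedCount (Graph.cycleC k) Y) ∧
    (3 ≤ X.vertexSet.ncard → X.vertexSet.ncard = Y.vertexSet.ncard →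
      X.hamCount = Y.hamCount) := by
  have hsupp : (fun S => X.SupportsPrime (lX ⁻¹' S)) = fun S => Y.SupportsPrime (lY ⁻¹' S) :=
    funext fun S => propext ⟨Graph.supportsPrime_of_edgeZeta_eq hzeta,
      Graph.supportsPrime_of_edgeZeta_eq (hzeta.mono fun _ h => h.symm)⟩
  have hcount : ∀ k : ℕ, 3 ≤ k → Graph.edgeInducedCount (Graph.cycleC k) X =
      Graph.edgeInducedCount (Graph.cycleC k) Y := by
    intro k hk
    obtain ⟨n, rfl⟩ := Nat.exists_eq_add_of_le' hk
    unfold Graph.edgeInducedCount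
    rw [← ((Graph.labelSet_injOn lX).mono fun R hR => hR.1).ncard_image,
      ← ((Graph.labelSet_injOn lY).mono fun R hR => hR.1).ncard_image,
      Graph.image_labelSet_cycles hlX, Graph.image_labelSet_cycles hlY, hsupp]
  refine ⟨hcount, fun h3 hV => ?_⟩
  unfold Graph.hamCount
  rw [← hV]
  exact hcount _ h3
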